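/- Let $\mathcal H$ be a complex Hilbert space with inner product $\langle x,y\rangle$, linear in $x$ and anti-linear in $y$. Let $B$ be a bounded anti-linear operator in $\mathcal H$ that is symmetric, i.e. $\langle Bx,y\rangle=\langle By,x\rangle$ for all $x,y\in\mathcal H$. Let $\delta\in\mathcal H$ be a unit vector that is cyclic for $B$, i.e. the set of vectors $f(B)\delta=\sum_n a_nB^n\delta$, where $f(t)=\sum_n a_nt^n$ runs over all polynomials with complex coefficients, is dense in $\mathcal H$. The operator $B^2$ is linear, bounded, self-adjoint and positive semi-definite; put $|B|=\sqrt{B^2}$. Let $\nu$ be the spectral measure of $|B|$ associated with $\delta$, i.e. the Borel measure with $\langle f(|B|)\delta,\delta\rangle=\int_0^\infty f(s)\,d\nu(s)$ for all $f\in C(\mathbb R)$, and let $\psi$ be a complex-valued Borel function with $|\psi(s)|\le1$ for all $s>0$ such that $$\langle f(|B|)B\delta,\delta\rangle=\int_0^\infty s f(s)\psi(s)\,d\nu(s)\qquad\text{for all } f\in C(\mathbb R)$$ (this determines $\psi$ up to values on a $\nu$-null subset of $(0,\infty)$). For a bounded self-adjoint operator $T$ let $E_T(\Delta)$ be the spectral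 projection of $T$ corresponding to a Borel set $\Delta\subset\mathbb R$. A vector $x$ is an element of maximal type for $T$ if, for every Borel set $\Delta$, $\langle E_T(\Delta)x,x\rangle=0$ implies $E_T(\Delta)=0$. The spectrum of $T$ has multiplicity $n$ on a Borel set $S$ if the restriction of $T$ to $\operatorname{Ran}E_T(S)$ is unitarily equivalent to the operator of multiplication by the independent variable in $L^2(\mu;\mathbb C^n)$ for some finite Borel measure $\mu$ on $\mathbb R$ with $\mu(\mathbb R\setminus S)=0$. Then: 1. $\delta$ is an element of maximal type for $|B|$. 2. The spectrum of $|B|$ has multiplicity one on $S_1=\{s>0:|\psi(s)|=1\}$. 3. The spectrum of $|B|$ has multiplicity two on $S_2=\{s>0:|\psi(s)|<1\}$. 4. If $0$ is an eigenvalue of $|B|$, then it has multiplicity one, i.e. $\dim\operatorname{Ker}|B|=1$. -/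

import Mathlib

namespace AntiLinear

open MeasureTheory
open scoped ComplexConjugate CompactlySupported BoundedContinuousFunction

universe u

/-! ### The spectral measures and the spectral projections of a bounded self-adjoint operator -/

section SpectralTheory

variable {H : Type u} [NormedAddCommGroup H] [InnerProductSpace ℂ H] [CompleteSpace H]

/-- The positive functional `f ↦ ⟨f(T)x, x⟩` on real continuous functions on the spectrum of the
self-adjoint operator `T`. -/
noncomputable def spectralFunctional {T : H →L[ℂ] H} (hT : IsSelfAdjoint T) (x : H) :
    C_c(spectrum ℝ T, ℝ) →ₚ[ℝ] ℝ :=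
  PositiveLinearMap.mk₀
    { toFun := fun f => (inner ℂ x (cfcHom hT (f : C(spectrum ℝ T, ℝ)) x)).re
      map_add' := fun f g => by
        have h : ((f + g : C_c(spectrum ℝ T, ℝ)) : C(spectrum ℝ T, ℝ)) =
            (f : C(spectrum ℝ T, ℝ)) + (g : C(spectrum ℝ T, ℝ)) := rfl
        rw [h, map_add, add_apply, inner_add_right, Complex.add_re]
      map_smul' := fun c f => by
        have h : ((c • f : C_c(spectrum ℝ T, ℝ)) : C(spectrum ℝ T, ℝ)) =
            c • (f : C(spectrum ℝ T, ℝ)) := rfl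
        rw [h, map_smul, smul_apply, inner_smul_right_eq_smul]
        simp }
    (fun f hf => by
      have h0 : (0 : C(spectrum ℝ T, ℝ)) ≤ (f : C(spectrum ℝ T, ℝ)) := fun s => hf s
      have h1 : (0 : H →L[ℂ] H) ≤ cfcHom hT (f : C(spectrum ℝ T, ℝ)) := by
        have := cfcHom_mono hT h0
        rwa [map_zero] at this
      have h2 := (ContinuousLinearMap.nonneg_iff_isPositive _).1 h1
      exact h2.re_inner_nonneg_right x)

/-- The spectral measure of the bounded self-adjoint operator `T` associated with the vector `x`,
as a Borel measure on `ℝ`: the representing measure of `f ↦ ⟨f(T)x, x⟩`. -/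
noncomputable def spectralMeasure {T : H →L[ℂ] H} (hT : IsSelfAdjoint T) (x : H) : Measure ℝ :=
  (RealRMK.rieszMeasure (spectralFunctional hT x)).map Subtype.val

instance {T : H →L[ℂ] H} (hT : IsSelfAdjoint T) (x : H) :
    IsFiniteMeasure (spectralMeasure hT x) := by
  unfold spectralMeasure
  infer_instance

/-- The defining property of the spectral measure, `⟨f(T)x, x⟩ = ∫ f dμ_x`. -/
theorem integral_spectralMeasure {T : H →L[ℂ] H} (hT : IsSelfAdjoint T) (x : H)
    (f : ℝ → ℝ) (hf : Continuous f) :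
    ∫ s, f s ∂(spectralMeasure hT x) = (inner ℂ x (cfc f T x)).re := by
  unfold spectralMeasure
  rw [integral_map (by fun_prop) hf.aestronglyMeasurable, cfc_apply f T hT hf.continuousOn]
  exact RealRMK.integral_rieszMeasure (spectralFunctional hT x)
    (CompactlySupportedContinuousMap.continuousMapEquiv
      (⟨_, hf.continuousOn.domRestrict⟩ : C(spectrum ℝ T, ℝ)))

theorem real_spectralMeasure_univ {T : H →L[ℂ] H} (hT : IsSelfAdjoint T) (x : H) :
    (spectralMeasure hT x).real Set.univ = ‖x‖ ^ 2 := by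
  have h := integral_spectralMeasure hT x (fun _ => 1) continuous_const
  rw [cfc_const_one ℝ T] at h
  simpa [inner_self_eq_norm_sq_to_K, ← Complex.ofReal_pow] using h

/-- Real-linear identities between the quadratic forms of self-adjoint operators pass to the
spectral measures. -/
theorem sum_spectralMeasure_eq_zero {T : H →L[ℂ] H} (hT : IsSelfAdjoint T)
    {ι : Type} [Fintype ι] (c : ι → ℝ) (z : ι → H)
    (h : ∀ A : H →L[ℂ] H, IsSelfAdjoint A → ∑ i, c i * (inner ℂ (z i) (A (z i))).re = 0)
    (Δ : Set ℝ) : ∑ i, c i * (spectralMeasure hT (z i)).real Δ = 0 := by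
  have hc : ∀ i, ((c i).toNNReal : ℝ) - ((-c i).toNNReal : ℝ) = c i := fun i => by
    rw [Real.coe_toNNReal', Real.coe_toNNReal', max_zero_sub_max_neg_zero_eq_self]
  have key : (∑ i, (c i).toNNReal • spectralMeasure hT (z i)) =
      ∑ i, (-c i).toNNReal • spectralMeasure hT (z i) := by
    apply ext_of_forall_integral_eq_of_IsFiniteMeasure
    intro f
    have hi : ∀ (a : ι → NNReal), ∫ s, f s ∂(∑ i, a i • spectralMeasure hT (z i)) =
        ∑ i, (a i : ℝ) * (inner ℂ (z i) (cfc f T (z i))).re := by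
      intro a
      rw [integral_finsetSum_measure (fun i _ => f.integrable _)]
      refine Finset.sum_congr rfl fun i _ => ?_
      rw [integral_smul_nnreal_measure, integral_spectralMeasure hT (z i) f f.continuous]
      rfl
    rw [hi, hi, ← sub_eq_zero, ← Finset.sum_sub_distrib, ← h (cfc f T) (cfc_predicate f T)]
    refine Finset.sum_congr rfl fun i _ => ?_
    rw [← sub_mul]
    congr 1
    exact hc i
  have h2 : ∀ (a : ι → NNReal), (∑ i, a i • spectralMeasure hT (z i)).real Δ =
      ∑ i, (a i : ℝ) * (spectralMeasure hT (z i)).real Δ := by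
    intro a
    rw [Measure.real, Measure.finsetSum_apply, ENNReal.toReal_sum (fun i _ => measure_ne_top _ _)]
    refine Finset.sum_congr rfl fun i _ => ?_
    rw [Measure.smul_apply, ENNReal.toReal_smul]
    rfl
  have h3 := congrArg (fun μ : Measure ℝ => μ.real Δ) key
  simp only [h2] at h3
  rw [← sub_eq_zero, ← Finset.sum_sub_distrib] at h3
  rw [← h3]
  refine Finset.sum_congr rfl fun i _ => ?_
  rw [← sub_mul, hc i]

/-- The difference `μ_{x+y}(Δ) - μ_{x-y}(Δ)`, which is `4 Re μ_{x,y}(Δ)`. -/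
noncomputable def polarDiff {T : H →L[ℂ] H} (hT : IsSelfAdjoint T) (Δ : Set ℝ) (x y : H) : ℝ :=
  (spectralMeasure hT (x + y)).real Δ - (spectralMeasure hT (x - y)).real Δ

theorem sum_polarDiff_eq_zero {T : H →L[ℂ] H} (hT : IsSelfAdjoint T)
    {ι : Type} [Fintype ι] (c : ι → ℝ) (x y : ι → H)
    (h : ∀ A : H →L[ℂ] H, IsSelfAdjoint A → ∑ i, c i * (inner ℂ (x i) (A (y i))).re = 0)
    (Δ : Set ℝ) : ∑ i, c i * polarDiff hT Δ (x i) (y i) = 0 := by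
  have := sum_spectralMeasure_eq_zero hT (ι := ι ⊕ ι) (Sum.elim c (fun i => -c i))
    (Sum.elim (fun i => x i + y i) (fun i => x i - y i)) (fun A hA => by
      have h4 : ∀ i, (inner ℂ (x i + y i) (A (x i + y i))).re -
          (inner ℂ (x i - y i) (A (x i - y i))).re = 4 * (inner ℂ (x i) (A (y i))).re := by
        intro i
        have h5 : inner ℂ (y i) (A (x i)) = conj (inner ℂ (x i) (A (y i))) := by
          rw [inner_conj_symm]
          exact ((ContinuousLinearMap.isSelfAdjoint_iff_isSymmetric.1 hA) (y i) (x i)).symm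
        simp only [map_add, map_sub, inner_add_left, inner_add_right, inner_sub_left,
          inner_sub_right, h5, Complex.add_re, Complex.sub_re, Complex.conj_re]
        ring
      rw [Fintype.sum_sum_type]
      simp only [Sum.elim_inl, Sum.elim_inr, neg_mul, Finset.sum_neg_distrib]
      rw [← sub_eq_add_neg, ← Finset.sum_sub_distrib]
      simp only [← mul_sub, h4]
      rw [← mul_zero (4 : ℝ), ← h A hA, Finset.mul_sum]
      exact Finset.sum_congr rfl fun i _ => by ring) Δ
  rw [Fintype.sum_sum_type] at this
  simp only [Sum.elim_inl, Sum.elim_inr, neg_mul, Finset.sum_neg_distrib] at this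
  rw [← sub_eq_add_neg, ← Finset.sum_sub_distrib] at this
  simp only [← mul_sub] at this
  exact this

theorem polarDiff_add_right {T : H →L[ℂ] H} (hT : IsSelfAdjoint T) (Δ : Set ℝ) (x y z : H) :
    polarDiff hT Δ x (y + z) = polarDiff hT Δ x y + polarDiff hT Δ x z := by
  have := sum_polarDiff_eq_zero hT ![1, -1, -1] ![x, x, x] ![y + z, y, z] (fun A _ => by
    simp [Fin.sum_univ_succ]
    ring) Δ
  simp [Fin.sum_univ_succ] at this
  linarith

theorem polarDiff_smul_right {T : H →L[ℂ] H} (hT : IsSelfAdjoint T) (Δ : Set ℝ) (c : ℂ)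
    (x y : H) : polarDiff hT Δ x (c • y) =
      c.re * polarDiff hT Δ x y + c.im * polarDiff hT Δ x (Complex.I • y) := by
  have := sum_polarDiff_eq_zero hT ![1, -c.re, -c.im] ![x, x, x] ![c • y, y, Complex.I • y]
    (fun A _ => by
      simp [Fin.sum_univ_succ]) Δ
  simp [Fin.sum_univ_succ] at this
  linarith

theorem polarDiff_comm {T : H →L[ℂ] H} (hT : IsSelfAdjoint T) (Δ : Set ℝ) (x y : H) :
    polarDiff hT Δ x y = polarDiff hT Δ y x := by
  have := sum_polarDiff_eq_zero hT ![1, -1] ![x, y] ![y, x] (fun A hA => by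
    have h5 : (inner ℂ y (A x)).re = (inner ℂ x (A y)).re := by
      have h6 : inner ℂ (A x) y = inner ℂ x (A y) :=
        (ContinuousLinearMap.isSelfAdjoint_iff_isSymmetric.1 hA) x y
      rw [← h6]
      exact inner_re_symm (𝕜 := ℂ) y (A x)
    simp [Fin.sum_univ_succ, h5]) Δ
  simp [Fin.sum_univ_succ] at this
  linarith

theorem polarDiff_I_smul {T : H →L[ℂ] H} (hT : IsSelfAdjoint T) (Δ : Set ℝ) (x y : H) :
    polarDiff hT Δ (Complex.I • x) y = - polarDiff hT Δ x (Complex.I • y) := by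
  have := sum_polarDiff_eq_zero hT ![1, 1] ![Complex.I • x, x] ![y, Complex.I • y] (fun A hA => by
    simp [Fin.sum_univ_succ]) Δ
  simp [Fin.sum_univ_succ] at this
  linarith

theorem polarDiff_self {T : H →L[ℂ] H} (hT : IsSelfAdjoint T) (Δ : Set ℝ) (x : H) :
    polarDiff hT Δ x x = 4 * (spectralMeasure hT x).real Δ := by
  have := sum_spectralMeasure_eq_zero hT ![1, -1, -4] ![x + x, x - x, x] (fun A hA => by
    simp [Fin.sum_univ_succ]
    ring) Δ
  simp [Fin.sum_univ_succ] at this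
  simp only [polarDiff, sub_self]
  linarith

theorem abs_polarDiff_le {T : H →L[ℂ] H} (hT : IsSelfAdjoint T) (Δ : Set ℝ) (x y : H) :
    |polarDiff hT Δ x y| ≤ 4 * ‖x‖ * ‖y‖ := by
  have hQ : ∀ z : H, (spectralMeasure hT z).real Δ ≤ ‖z‖ ^ 2 := fun z => by
    rw [← real_spectralMeasure_univ hT z]
    exact measureReal_mono (Set.subset_univ _)
  have h1 : ∀ x y : H, |polarDiff hT Δ x y| ≤ 2 * (‖x‖ ^ 2 + ‖y‖ ^ 2) := by
    intro x y
    have hp := parallelogram_law_with_norm ℂ x y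
    have h2 := hQ (x + y)
    have h3 := hQ (x - y)
    have h4 : 0 ≤ (spectralMeasure hT (x + y)).real Δ := measureReal_nonneg
    have h5 : 0 ≤ (spectralMeasure hT (x - y)).real Δ := measureReal_nonneg
    rw [polarDiff, abs_le]
    constructor <;> nlinarith [sq_nonneg ‖x + y‖, sq_nonneg ‖x - y‖]
  have hr : ∀ (r : ℝ) (x y : H), polarDiff hT Δ x ((r : ℂ) • y) = r * polarDiff hT Δ x y := by
    intro r x y
    rw [polarDiff_smul_right hT Δ (r : ℂ) x y, Complex.ofReal_re, Complex.ofReal_im, zero_mul,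
      add_zero]
  have hl : ∀ (r : ℝ) (x y : H), polarDiff hT Δ ((r : ℂ) • x) y = r * polarDiff hT Δ x y := by
    intro r x y
    rw [polarDiff_comm, hr, polarDiff_comm]
  rcases eq_or_ne x 0 with rfl | hx
  · rw [polarDiff_comm]
    simp [polarDiff]
  rcases eq_or_ne y 0 with rfl | hy
  · simp [polarDiff]
  have hx' : ‖x‖ ≠ 0 := norm_ne_zero_iff.2 hx
  have hy' : ‖y‖ ≠ 0 := norm_ne_zero_iff.2 hy
  have e1 : x = ((‖x‖ : ℝ) : ℂ) • (((‖x‖⁻¹ : ℝ) : ℂ) • x) := by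
    rw [smul_smul, ← Complex.ofReal_mul, mul_inv_cancel₀ hx']; simp
  have e2 : y = ((‖y‖ : ℝ) : ℂ) • (((‖y‖⁻¹ : ℝ) : ℂ) • y) := by
    rw [smul_smul, ← Complex.ofReal_mul, mul_inv_cancel₀ hy']; simp
  have n1 : ‖((‖x‖⁻¹ : ℝ) : ℂ) • x‖ = 1 := by
    rw [norm_smul, Complex.norm_real, norm_inv, norm_norm, inv_mul_cancel₀ hx']
  have n2 : ‖((‖y‖⁻¹ : ℝ) : ℂ) • y‖ = 1 := by
    rw [norm_smul, Complex.norm_real, norm_inv, norm_norm, inv_mul_cancel₀ hy']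
  have h6 := h1 (((‖x‖⁻¹ : ℝ) : ℂ) • x) (((‖y‖⁻¹ : ℝ) : ℂ) • y)
  rw [n1, n2] at h6
  have e3 : polarDiff hT Δ x y = ‖x‖ * (‖y‖ *
      polarDiff hT Δ (((‖x‖⁻¹ : ℝ) : ℂ) • x) (((‖y‖⁻¹ : ℝ) : ℂ) • y)) := by
    rw [← hr, ← e2, ← hl, ← e1]
  rw [e3, abs_mul, abs_mul, abs_norm, abs_norm]
  calc _ ≤ ‖x‖ * (‖y‖ * 4) := by gcongr; linarith
    _ = 4 * ‖x‖ * ‖y‖ := by ring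

/-- Existence and uniqueness of the spectral projection `E_T(Δ)`, characterised by
`⟨E_T(Δ)x, x⟩ = μ_x(Δ)` for all `x`. -/
theorem existsUnique_spectralProjection {T : H →L[ℂ] H} (hT : IsSelfAdjoint T) (Δ : Set ℝ) :
    ∃! E : H →L[ℂ] H, ∀ x : H, inner ℂ x (E x) = ((spectralMeasure hT x).real Δ : ℂ) := by
  let F : H → H → ℂ := fun x y => (polarDiff hT Δ x y / 4 : ℝ) -
    (polarDiff hT Δ x (Complex.I • y) / 4 : ℝ) * Complex.I
  have hsmul : ∀ (c : ℂ) (x y : H), F x (c • y) = c * F x y := by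
    intro c x y
    have h1 := polarDiff_smul_right hT Δ c x y
    have h2 := polarDiff_smul_right hT Δ (Complex.I * c) x y
    rw [mul_smul] at h2
    simp only [F, h1, h2]
    apply Complex.ext <;> simp <;> ring
  have hadd : ∀ (x y z : H), F x (y + z) = F x y + F x z := by
    intro x y z
    simp only [F, smul_add, polarDiff_add_right]
    push_cast
    ring
  have hconj : ∀ x y : H, F x y = conj (F y x) := by
    intro x y
    have h1 : polarDiff hT Δ x (Complex.I • y) = - polarDiff hT Δ y (Complex.I • x) := by
      rw [polarDiff_comm, polarDiff_I_smul]
    simp only [F, h1, polarDiff_comm hT Δ x y, map_sub, map_mul, Complex.conj_ofReal,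
      Complex.conj_I]
    push_cast
    ring
  let L : H →ₗ⋆[ℂ] H →ₗ[ℂ] ℂ := LinearMap.mk₂'ₛₗ _ _ F
    (fun x x' y => by rw [hconj, hadd, map_add, ← hconj, ← hconj])
    (fun c x y => by rw [hconj, hsmul, map_mul, ← hconj]; rfl)
    (fun x y y' => hadd x y y')
    (fun c x y => hsmul c x y)
  let B : H →L⋆[ℂ] H →L[ℂ] ℂ := L.mkContinuous₂ 2 (fun x y => by
    have h1 := abs_polarDiff_le hT Δ x y
    have h2 := abs_polarDiff_le hT Δ x (Complex.I • y)
    rw [norm_smul, Complex.norm_I, one_mul] at h2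
    change ‖F x y‖ ≤ _
    refine (norm_sub_le _ _).trans ?_
    rw [norm_mul, Complex.norm_I, mul_one, Complex.norm_real, Complex.norm_real, Real.norm_eq_abs,
      Real.norm_eq_abs, abs_div, abs_div]
    norm_num
    linarith)
  have hself : ∀ x, F x x = ((spectralMeasure hT x).real Δ : ℂ) := by
    intro x
    have h1 : polarDiff hT Δ x (Complex.I • x) = 0 := by
      have h2 := polarDiff_I_smul hT Δ x x
      rw [polarDiff_comm] at h2
      linarith
    simp only [F, h1, polarDiff_self]
    simp
  refine ⟨ContinuousLinearMap.adjoint (InnerProductSpace.continuousLinearMapOfBilin B),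
    fun x => ?_, fun E hE => ?_⟩
  · rw [ContinuousLinearMap.adjoint_inner_right,
      InnerProductSpace.continuousLinearMapOfBilin_apply]
    exact hself x
  · rw [← sub_eq_zero]
    have : ∀ x, inner ℂ x ((E - ContinuousLinearMap.adjoint
        (InnerProductSpace.continuousLinearMapOfBilin B)) x) = 0 := by
      intro x
      rw [sub_apply, inner_sub_right, hE,
        ContinuousLinearMap.adjoint_inner_right,
        InnerProductSpace.continuousLinearMapOfBilin_apply]
      exact sub_eq_zero.2 (hself x).symm
    have h2 := (inner_map_self_eq_zero (E - ContinuousLinearMap.adjoint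
        (InnerProductSpace.continuousLinearMapOfBilin B)).toLinearMap).1 (fun x => by
      rw [← inner_conj_symm]
      exact (congrArg conj (this x)).trans (map_zero _))
    ext x
    exact congrArg (fun A : H →ₗ[ℂ] H => A x) h2

/-- The spectral projection `E_T(Δ)` of the bounded self-adjoint operator `T`: the unique bounded
operator with `⟨E_T(Δ)x, x⟩ = μ_x(Δ)` for all `x`, where `μ_x` is the spectral measure of `T`
associated with `x`. Only used for Borel sets `Δ`. -/
noncomputable def spectralProjection {T : H →L[ℂ] H} (hT : IsSelfAdjoint T) (Δ : Set ℝ) :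
    H →L[ℂ] H :=
  (existsUnique_spectralProjection hT Δ).choose

theorem inner_spectralProjection {T : H →L[ℂ] H} (hT : IsSelfAdjoint T) (Δ : Set ℝ) (x : H) :
    inner ℂ x (spectralProjection hT Δ x) = ((spectralMeasure hT x).real Δ : ℂ) :=
  (existsUnique_spectralProjection hT Δ).choose_spec.1 x

/-- `x` is an element of maximal type for `T`: for every Borel set `Δ`,
`⟨E_T(Δ)x, x⟩ = 0` implies `E_T(Δ) = 0`. -/
def IsMaximalType {T : H →L[ℂ] H} (hT : IsSelfAdjoint T) (x : H) : Prop :=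
  ∀ Δ : Set ℝ, MeasurableSet Δ →
    inner ℂ x (spectralProjection hT Δ x) = 0 → spectralProjection hT Δ = 0

/-- The spectrum of `T` has (uniform) multiplicity `n` on the Borel set `S`: the part of `T` in the
spectral subspace `Ran E_T(S)` is unitarily equivalent to the operator of multiplication by the
independent variable in `L²(μ; ℂⁿ)`, for some finite Borel measure `μ` carried by `S`.
(For `n ≥ 1` the measure `μ` is then necessarily of the type of `E_T` on `S`.) -/
def HasSpectralMultiplicityOn {T : H →L[ℂ] H} (hT : IsSelfAdjoint T) (S : Set ℝ) (n : ℕ) : Prop :=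
  ∃ μ : Measure ℝ, IsFiniteMeasure μ ∧ μ Sᶜ = 0 ∧
    ∃ U : (spectralProjection hT S).range ≃ₗᵢ[ℂ]
        Lp (EuclideanSpace ℂ (Fin n)) 2 μ,
      ∀ x : (spectralProjection hT S).range,
        ∃ hx : T x ∈ (spectralProjection hT S).range,
          (U ⟨T x, hx⟩ : ℝ → EuclideanSpace ℂ (Fin n)) =ᵐ[μ] fun s => (s : ℂ) • U x s

end SpectralTheory

/-! ### Symmetric anti-linear operators -/

section AntiLinearOperators

variable {H : Type u} [NormedAddCommGroup H] [InnerProductSpace ℂ H] [CompleteSpace H]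

/-- The bounded anti-linear operator `B` is symmetric: `⟨Bx, y⟩ = ⟨By, x⟩`, where the inner product
`⟨x, y⟩`, linear in `x`, is `inner ℂ y x`. -/
def IsSymm (B : H →L⋆[ℂ] H) : Prop :=
  ∀ x y : H, inner ℂ y (B x) = inner ℂ x (B y)

/-- `f(B)x = ∑ aₙ Bⁿ x` for a complex polynomial `f(t) = ∑ aₙ tⁿ`. -/
noncomputable def polyApply (B : H →L⋆[ℂ] H) (f : Polynomial ℂ) (x : H) : H :=
  f.sum fun n a => a • (⇑B)^[n] x

/-- `δ` is cyclic for `B`: the vectors `f(B)δ`, `f` a polynomial, are dense. -/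
def IsCyclicVector (B : H →L⋆[ℂ] H) (δ : H) : Prop :=
  closure {y : H | ∃ f : Polynomial ℂ, y = polyApply B f δ} = Set.univ

/-- The linear operator `B²`. -/
def square (B : H →L⋆[ℂ] H) : H →L[ℂ] H :=
  B.comp B

/-- `|B| = √(B²)`. -/
noncomputable def absOp (B : H →L⋆[ℂ] H) : H →L[ℂ] H :=
  CFC.sqrt (square B)

theorem isSelfAdjoint_absOp (B : H →L⋆[ℂ] H) : IsSelfAdjoint (absOp B) :=
  IsSelfAdjoint.of_nonneg (CFC.sqrt_nonneg _)

/-- The measure `ν` of the spectral data of `B`: the spectral measure of `|B|` associated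
with `δ`. -/
noncomputable def nu (B : H →L⋆[ℂ] H) (δ : H) : Measure ℝ :=
  spectralMeasure (isSelfAdjoint_absOp B) δ

/-- `ψ` is a Borel representative of the phase function of the spectral data of `B`, bounded by `1`
at every point of `(0, ∞)`:
`⟨f(|B|)Bδ, δ⟩ = ∫ s f(s) ψ(s) dν(s)` over `(0, ∞)` for all complex continuous `f` on `ℝ`.
Here `f(|B|)` is the continuous functional calculus; the values of `ψ` on `(-∞, 0]` play no role. -/
def IsPhaseFunction (B : H →L⋆[ℂ] H) (δ : H) (ψ : ℝ → ℂ) : Prop :=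
  Measurable ψ ∧ (∀ s : ℝ, 0 < s → ‖ψ s‖ ≤ 1) ∧
    ∀ f : C(ℝ, ℂ), inner ℂ δ (cfc (fun z : ℂ => f z.re) (absOp B) (B δ)) =
      ∫ s in Set.Ioi 0, (s : ℂ) * f s * ψ s ∂(nu B δ)

end AntiLinearOperators

end AntiLinear

/-! Since `B` commutes with `B²`, it satisfies `B f(|B|) = f̄(|B|) B` for continuous `f`. Even
powers of `B` are powers of `|B|²`, so cyclicity says that the vectors `f(|B|)δ + g(|B|)Bδ` are
dense (`denseRange_cyclicVec`): two generators suffice for `|B|`.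

Symmetry of `B` gives `⟨h(|B|)Bδ, Bδ⟩ = ∫ s² h dν` for real `h`. With the definitions of `ν` and
`ψ`, the squared norm of such a vector is the integral of the quadratic form with Gram matrix of
diagonal `1, s²`, off-diagonal entries `sψ` and its conjugate, and determinant `s²(1 - |ψ|²)`.
Completing the square turns the integrand into `|f + sψg|² + s²(1 - |ψ|²)|g|²`, so `(f, g) ↦ (f +
sψg, s√(1 - |ψ|²) g)` induces an isometry `U` of `H` into `L²(ν; ℂ²)` (`exists_representation`).

`U` carries `|B|` to multiplication by `s`. Its range consists exactly of the functions whose second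
component vanishes off `S₂ = {s > 0 : |ψ| < 1}` (`ae_apply_one_eq_zero`, `exists_apply_eq`), so
spectral projections become multiplications by indicators (`spectralProjection_apply`). Hence
`ν`-null sets have zero projection, and the fibre is `ℂ²` on `S₂` and `ℂ` on `S₁`.

The kernel is treated directly: if `|B|x = 0` then `Bx = 0`, so `x` is orthogonal to `Bⁿδ` for `n ≥
1`, and only its inner product with `δ` can be nonzero. -/

namespace AntiLinear

open MeasureTheory
open scoped ComplexConjugate

universe u

/-! ### Continuous functions of a self-adjoint operator, and spectral measures -/

section FunctionalCalculus

variable {H : Type u} [NormedAddCommGroup H] [InnerProductSpace ℂ H] [CompleteSpace H]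

/-- `f(T)` for a complex continuous function `f` on the real line. -/
noncomputable def contFun (T : H →L[ℂ] H) (f : C(ℝ, ℂ)) : H →L[ℂ] H :=
  cfc (fun z : ℂ => f z.re) T

theorem continuous_comp_re (f : C(ℝ, ℂ)) : Continuous fun z : ℂ => f z.re :=
  f.continuous.comp Complex.continuous_re

theorem contFun_add (T : H →L[ℂ] H) (f g : C(ℝ, ℂ)) :
    contFun T (f + g) = contFun T f + contFun T g :=
  cfc_add T (fun z : ℂ => f z.re) (fun z : ℂ => g z.re) (continuous_comp_re f).continuousOn
    (continuous_comp_re g).continuousOn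

theorem contFun_mul (T : H →L[ℂ] H) (f g : C(ℝ, ℂ)) :
    contFun T (f * g) = contFun T f * contFun T g :=
  cfc_mul (fun z : ℂ => f z.re) (fun z : ℂ => g z.re) T (continuous_comp_re f).continuousOn
    (continuous_comp_re g).continuousOn

theorem contFun_smul (T : H →L[ℂ] H) (c : ℂ) (f : C(ℝ, ℂ)) :
    contFun T (c • f) = c • contFun T f :=
  cfc_smul c (fun z : ℂ => f z.re) T (continuous_comp_re f).continuousOn

theorem contFun_star (T : H →L[ℂ] H) (f : C(ℝ, ℂ)) :
    contFun T (star f) = ContinuousLinearMap.adjoint (contFun T f) :=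
  cfc_star (fun z : ℂ => f z.re) T

theorem contFun_one {T : H →L[ℂ] H} (hT : IsSelfAdjoint T) : contFun T 1 = 1 :=
  cfc_const_one ℂ T (hT.isStarNormal)

/-- The inclusion of the real line in the complex plane. -/
noncomputable def idFun : C(ℝ, ℂ) := ⟨fun s => (s : ℂ), Complex.continuous_ofReal⟩

theorem contFun_id {T : H →L[ℂ] H} (hT : IsSelfAdjoint T) : contFun T idFun = T := by
  have h := cfc_real_eq_complex (fun s : ℝ => s) hT
  rw [cfc_id' ℝ T hT] at h
  exact h.symm

theorem inner_contFun_left (T : H →L[ℂ] H) (f : C(ℝ, ℂ)) (x y : H) :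
    inner ℂ (contFun T f x) y = inner ℂ x (contFun T (star f) y) := by
  rw [contFun_star, ContinuousLinearMap.adjoint_inner_right]

theorem inner_contFun_ofReal {T : H →L[ℂ] H} (hT : IsSelfAdjoint T) (x : H) (f : C(ℝ, ℝ)) :
    inner ℂ x (contFun T ⟨fun s => (f s : ℂ), by fun_prop⟩ x) =
      ((∫ s, f s ∂(spectralMeasure hT x) : ℝ) : ℂ) := by
  rw [integral_spectralMeasure hT x f f.continuous, cfc_real_eq_complex (f : ℝ → ℝ) hT]
  have hs : IsSelfAdjoint (cfc (fun z : ℂ => (f z.re : ℂ)) T) := by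
    rw [← cfc_real_eq_complex (f : ℝ → ℝ) hT]
    exact cfc_predicate _ _
  have h := (ContinuousLinearMap.isSelfAdjoint_iff_isSymmetric.1 hs).coe_re_inner_self_apply x
  have h' := (ContinuousLinearMap.isSelfAdjoint_iff_isSymmetric.1 hs) x x
  simp only [ContinuousLinearMap.coe_coe] at h h'
  exact h.symm

theorem spectralMeasure_compl_spectrum {T : H →L[ℂ] H} (hT : IsSelfAdjoint T) (x : H) :
    spectralMeasure hT x (spectrum ℝ T)ᶜ = 0 := by
  have hm : MeasurableSet (spectrum ℝ T) := (spectrum.isClosed T).measurableSet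
  unfold spectralMeasure
  rw [Measure.map_apply measurable_subtype_coe hm.compl]
  have : (Subtype.val : spectrum ℝ T → ℝ) ⁻¹' (spectrum ℝ T)ᶜ = ∅ := by
    ext s
    simp
  rw [this, measure_empty]

theorem ae_mem_spectrum {T : H →L[ℂ] H} (hT : IsSelfAdjoint T) (x : H) :
    ∀ᵐ s ∂(spectralMeasure hT x), s ∈ spectrum ℝ T :=
  spectralMeasure_compl_spectrum hT x

/-- The measure lives on the compact spectrum, so a continuous function on `ℝ` is essentially
bounded even if it is unbounded on the line. -/
theorem exists_bound_of_continuous {T : H →L[ℂ] H} (hT : IsSelfAdjoint T) (x : H) {E : Type*}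
    [SeminormedAddCommGroup E] {f : ℝ → E} (hf : Continuous f) :
    ∃ C, ∀ᵐ s ∂(spectralMeasure hT x), ‖f s‖ ≤ C := by
  obtain ⟨C, hC⟩ := (spectrum.isCompact (𝕜 := ℝ) T).exists_bound_of_continuousOn hf.continuousOn
  exact ⟨C, (ae_mem_spectrum hT x).mono fun s hs => hC s hs⟩

theorem inner_contFun {T : H →L[ℂ] H} (hT : IsSelfAdjoint T) (x : H) (f : C(ℝ, ℂ)) :
    inner ℂ x (contFun T f x) = ∫ s, f s ∂(spectralMeasure hT x) := by
  have hi : Integrable f (spectralMeasure hT x) := by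
    obtain ⟨C, hC⟩ := exists_bound_of_continuous hT x f.continuous
    exact Integrable.of_bound f.continuous.aestronglyMeasurable C hC
  let fr : C(ℝ, ℝ) := ⟨fun s => (f s).re, by fun_prop⟩
  let fi : C(ℝ, ℝ) := ⟨fun s => (f s).im, by fun_prop⟩
  have hf : f = (⟨fun s => (fr s : ℂ), by fun_prop⟩ : C(ℝ, ℂ)) +
      Complex.I • (⟨fun s => (fi s : ℂ), by fun_prop⟩ : C(ℝ, ℂ)) := by
    ext s
    simp [fr, fi, mul_comm Complex.I]
  conv_lhs => rw [hf]
  rw [contFun_add, contFun_smul, add_apply, inner_add_right,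
    smul_apply, inner_smul_right, inner_contFun_ofReal hT, inner_contFun_ofReal hT,
    mul_comm Complex.I]
  exact integral_re_add_im (𝕜 := ℂ) hi

end FunctionalCalculus

/-! ### The algebra of a symmetric anti-linear operator -/

section AntiLinearAlgebra

variable {H : Type u} [NormedAddCommGroup H] [InnerProductSpace ℂ H]

theorem square_apply (B : H →L⋆[ℂ] H) (x : H) : square B x = B (B x) := rfl

/-- Symmetry gives `⟨B²x, x⟩ = ‖Bx‖²`. -/
theorem square_nonneg {B : H →L⋆[ℂ] H} (hB : IsSymm B) : 0 ≤ square B := by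
  rw [ContinuousLinearMap.nonneg_iff_isPositive, ContinuousLinearMap.isPositive_iff_complex]
  intro x
  have h : inner ℂ (square B x) x = inner ℂ (B x) (B x) := by
    rw [← inner_conj_symm, square_apply, hB (B x) x, inner_conj_symm]
  rw [h, inner_self_eq_norm_sq_to_K]
  norm_cast
  exact ⟨rfl, by positivity⟩

theorem inner_iterate_of_apply_eq_zero {B : H →L⋆[ℂ] H} (hB : IsSymm B) {δ x : H}
    (hx : B x = 0) (hδ : inner ℂ δ x = 0) (n : ℕ) : inner ℂ x (B^[n] δ) = 0 := by
  cases n with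
  | zero => simpa using inner_eq_zero_symm.1 hδ
  | succ n => rw [Function.iterate_succ_apply', hB, hx, inner_zero_right]

theorem eq_zero_of_forall_inner_iterate {B : H →L⋆[ℂ] H} {δ x : H} (hcyc : IsCyclicVector B δ)
    (hx : ∀ n, inner ℂ x (B^[n] δ) = 0) : x = 0 := by
  have h : ∀ y ∈ closure {y : H | ∃ f : Polynomial ℂ, y = polyApply B f δ}, inner ℂ x y = 0 := by
    intro y hy
    refine closure_minimal (t := {y | inner ℂ x y = 0}) ?_
      (isClosed_eq (by fun_prop) continuous_const) hy
    rintro _ ⟨f, rfl⟩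
    simp only [polyApply, Polynomial.sum_def, Set.mem_ofPred_eq, inner_sum, inner_smul_right, hx,
      mul_zero, Finset.sum_const_zero]
  rw [hcyc] at h
  exact inner_self_eq_zero.1 (h x (Set.mem_univ x))

variable [CompleteSpace H]

/-- Moving `B` past a scalar conjugates it, while `T` is self-adjoint and commutes with `B`. So the
identity holds for constants and the coordinate function; it survives sums, products and uniform
limits, and Stone–Weierstrass does the rest. -/
theorem antilinear_cfcHom {B : H →L⋆[ℂ] H} {T : H →L[ℂ] H} (hT : IsSelfAdjoint T)
    (hTB : ∀ x, B (T x) = T (B x)) (f : C(spectrum ℂ T, ℂ)) (x : H) :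
    B (cfcHom hT.isStarNormal f x) = cfcHom hT.isStarNormal (star f) (B x) := by
  revert x
  have hid : cfcHom hT.isStarNormal (ContinuousMap.restrict (spectrum ℂ T) (.id ℂ)) = T :=
    cfcHom_id hT.isStarNormal
  have hconst : ∀ r : ℂ, cfcHom hT.isStarNormal (ContinuousMap.const (spectrum ℂ T) r) =
      algebraMap ℂ (H →L[ℂ] H) r := fun r => AlgHomClass.commutes (cfcHom hT.isStarNormal) r
  induction f using ContinuousMap.induction_on_of_compact with
  | const r =>
    intro x
    have hs : star (ContinuousMap.const (spectrum ℂ T) r) = ContinuousMap.const _ (star r) := rfl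
    rw [hs, hconst, hconst]
    simp [Algebra.algebraMap_eq_smul_one]
  | id =>
    intro x
    rw [map_star, hid, hT.star_eq, hTB]
  | star_id =>
    intro x
    rw [star_star, map_star, hid, hT.star_eq, hTB]
  | add f g hf hg =>
    intro x
    rw [star_add, map_add, map_add, add_apply, add_apply,
      map_add, hf, hg]
  | mul f g hf hg =>
    intro x
    rw [star_mul', map_mul, map_mul, mul_apply_eq_comp,
      mul_apply_eq_comp, hf, hg]
  | frequently f hf =>
    intro x
    have hcl : IsClosed {g : C(spectrum ℂ T, ℂ) |
        B (cfcHom hT.isStarNormal g x) = cfcHom hT.isStarNormal (star g) (B x)} := by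
      have hc := cfcHom_continuous (R := ℂ) (hT.isStarNormal)
      have h1 : ∀ y : H, Continuous fun g : C(spectrum ℂ T, ℂ) =>
          cfcHom hT.isStarNormal g y := fun y => hc.clm_apply continuous_const
      exact isClosed_eq (B.continuous.comp (h1 x)) ((h1 (B x)).comp continuous_star)
    exact (hf.mono fun g hg => hg x).mem_of_closed hcl

theorem antilinear_cfc {B : H →L⋆[ℂ] H} {T : H →L[ℂ] H} (hT : IsSelfAdjoint T)
    (hTB : ∀ x, B (T x) = T (B x)) {f : ℂ → ℂ} (hf : Continuous f) (x : H) :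
    B (cfc f T x) = cfc (fun z => conj (f z)) T (B x) := by
  rw [cfc_apply f T hT.isStarNormal hf.continuousOn,
    cfc_apply (fun z => conj (f z)) T hT.isStarNormal
      (Complex.continuous_conj.comp hf).continuousOn, antilinear_cfcHom hT hTB]
  rfl

theorem antilinear_contFun {B : H →L⋆[ℂ] H} {T : H →L[ℂ] H} (hT : IsSelfAdjoint T)
    (hTB : ∀ x, B (T x) = T (B x)) (f : C(ℝ, ℂ)) (x : H) :
    B (contFun T f x) = contFun T (star f) (B x) :=
  antilinear_cfc hT hTB (continuous_comp_re f) x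

theorem absOp_absOp {B : H →L⋆[ℂ] H} (hB : IsSymm B) (x : H) :
    absOp B (absOp B x) = B (B x) := by
  have h := CFC.sqrt_mul_sqrt_self (square B) (square_nonneg hB)
  exact congrArg (fun A : H →L[ℂ] H => A x) h

/-- `B` commutes with its own square, and the square root is a real function, so the conjugation in
`antilinear_cfc` has no effect. -/
theorem antilinear_absOp {B : H →L⋆[ℂ] H} (hB : IsSymm B) (x : H) :
    B (absOp B x) = absOp B (B x) := by
  have hsa : IsSelfAdjoint (square B) := IsSelfAdjoint.of_nonneg (square_nonneg hB)
  have h : absOp B = cfc (fun z : ℂ => ((Real.sqrt z.re : ℝ) : ℂ)) (square B) := by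
    rw [absOp, CFC.sqrt_eq_real_sqrt _ (square_nonneg hB), cfcₙ_eq_cfc, cfc_real_eq_complex _ hsa]
  rw [h, antilinear_cfc hsa (fun _ => rfl) (by fun_prop)]
  simp

theorem antilinear_contFun_absOp {B : H →L⋆[ℂ] H} (hB : IsSymm B) (f : C(ℝ, ℂ)) (x : H) :
    B (contFun (absOp B) f x) = contFun (absOp B) (star f) (B x) :=
  antilinear_contFun (isSelfAdjoint_absOp B) (antilinear_absOp hB) f x

theorem contFun_absOp_sq {B : H →L⋆[ℂ] H} (hB : IsSymm B) (x : H) :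
    contFun (absOp B) (idFun * idFun) x = B (B x) := by
  rw [contFun_mul, contFun_id (isSelfAdjoint_absOp B), mul_apply_eq_comp,
    absOp_absOp hB]

/-- On the kernel the functional `x ↦ ⟨x, δ⟩` is injective: a vector killed by `B` and orthogonal to
`δ` is orthogonal to every `Bⁿδ`. -/
theorem finrank_eigenspace_absOp_zero {B : H →L⋆[ℂ] H} (hB : IsSymm B) {δ : H}
    (hcyc : IsCyclicVector B δ) (h0 : Module.End.HasEigenvalue (absOp B : H →ₗ[ℂ] H) 0) :
    Module.finrank ℂ (Module.End.eigenspace (absOp B : H →ₗ[ℂ] H) 0) = 1 := by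
  have hker : ∀ x ∈ Module.End.eigenspace (absOp B : H →ₗ[ℂ] H) 0, B x = 0 := by
    intro x hx
    have hx' : absOp B x = 0 := by simpa using Module.End.mem_eigenspace_iff.1 hx
    have h1 : inner ℂ (B x) (B x) = 0 := by
      rw [hB x (B x), ← absOp_absOp hB, hx', map_zero, inner_zero_right]
    exact inner_self_eq_zero.1 h1
  let L : Module.End.eigenspace (absOp B : H →ₗ[ℂ] H) 0 →ₗ[ℂ] ℂ :=
    (innerSL ℂ δ).toLinearMap ∘ₗ Submodule.subtype _
  have hL : Function.Injective L := by
    rw [← LinearMap.ker_eq_bot, LinearMap.ker_eq_bot']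
    intro x hx
    exact Subtype.ext (eq_zero_of_forall_inner_iterate hcyc
      (inner_iterate_of_apply_eq_zero hB (hker x x.2) hx))
  have hle : Module.finrank ℂ (Module.End.eigenspace (absOp B : H →ₗ[ℂ] H) 0) ≤ 1 := by
    simpa using LinearMap.finrank_le_finrank_of_injective hL
  have : FiniteDimensional ℂ (Module.End.eigenspace (absOp B : H →ₗ[ℂ] H) 0) :=
    FiniteDimensional.of_injective L hL
  have hpos : 0 < Module.finrank ℂ (Module.End.eigenspace (absOp B : H →ₗ[ℂ] H) 0) :=
    Submodule.one_le_finrank_iff.2 h0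
  omega

end AntiLinearAlgebra

/-! ### The model space -/

section Model

/-- `s ψ(s)` on the positive half-line, extended by zero. -/
noncomputable def phaseWeight (ψ : ℝ → ℂ) (s : ℝ) : ℂ :=
  if 0 < s then s * ψ s else 0

/-- `s √(1 - |ψ(s)|²)` on the positive half-line, extended by zero. -/
noncomputable def defectWeight (ψ : ℝ → ℂ) (s : ℝ) : ℝ :=
  if 0 < s then s * Real.sqrt (1 - ‖ψ s‖ ^ 2) else 0

theorem measurable_phaseWeight {ψ : ℝ → ℂ} (hψ : Measurable ψ) : Measurable (phaseWeight ψ) :=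
  Measurable.ite measurableSet_Ioi (by fun_prop) measurable_const

theorem measurable_defectWeight {ψ : ℝ → ℂ} (hψ : Measurable ψ) : Measurable (defectWeight ψ) :=
  Measurable.ite measurableSet_Ioi (by fun_prop) measurable_const

theorem defectWeight_nonneg (ψ : ℝ → ℂ) (s : ℝ) : 0 ≤ defectWeight ψ s := by
  unfold defectWeight
  split_ifs <;> positivity

/-- This is the identity behind completing the square. It needs `s ≥ 0`, because both weights are
zero on the negative half-line. -/
theorem norm_sq_phaseWeight_add_sq_defectWeight {ψ : ℝ → ℂ} (h1 : ∀ s : ℝ, 0 < s → ‖ψ s‖ ≤ 1)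
    {s : ℝ} (hs : 0 ≤ s) : ‖phaseWeight ψ s‖ ^ 2 + defectWeight ψ s ^ 2 = s ^ 2 := by
  rcases hs.eq_or_lt with rfl | hs
  · simp [phaseWeight, defectWeight]
  · have : ‖ψ s‖ ^ 2 ≤ 1 := pow_le_one₀ (norm_nonneg _) (h1 s hs)
    rw [phaseWeight, defectWeight, if_pos hs, if_pos hs, norm_mul, mul_pow, mul_pow,
      Real.sq_sqrt (by linarith), Complex.norm_real, Real.norm_eq_abs, sq_abs]
    ring

theorem norm_phaseWeight_le {ψ : ℝ → ℂ} (h1 : ∀ s : ℝ, 0 < s → ‖ψ s‖ ≤ 1)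
    {s : ℝ} (hs : 0 ≤ s) : ‖phaseWeight ψ s‖ ≤ s := by
  have := norm_sq_phaseWeight_add_sq_defectWeight h1 hs
  exact abs_le_of_sq_le_sq' (by nlinarith [sq_nonneg (defectWeight ψ s)]) hs |>.2

theorem defectWeight_le {ψ : ℝ → ℂ} (h1 : ∀ s : ℝ, 0 < s → ‖ψ s‖ ≤ 1)
    {s : ℝ} (hs : 0 ≤ s) : defectWeight ψ s ≤ s := by
  have := norm_sq_phaseWeight_add_sq_defectWeight h1 hs
  exact abs_le_of_sq_le_sq' (by nlinarith [sq_nonneg ‖phaseWeight ψ s‖]) hs |>.2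

theorem defectWeight_eq_zero {ψ : ℝ → ℂ} (h1 : ∀ s : ℝ, 0 < s → ‖ψ s‖ ≤ 1) {s : ℝ}
    (hs : ¬ (0 < s ∧ ‖ψ s‖ < 1)) : defectWeight ψ s = 0 := by
  unfold defectWeight
  split_ifs with h
  · have h2 : ‖ψ s‖ = 1 := le_antisymm (h1 s h) (not_lt.1 fun h' => hs ⟨h, h'⟩)
    simp [h2]
  · rfl

theorem defectWeight_pos {ψ : ℝ → ℂ} {s : ℝ} (hs : 0 < s ∧ ‖ψ s‖ < 1) :
    0 < defectWeight ψ s := by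
  rw [defectWeight, if_pos hs.1]
  have : ‖ψ s‖ ^ 2 < 1 := pow_lt_one₀ (norm_nonneg _) hs.2 two_ne_zero
  have := hs.1
  have : 0 < √(1 - ‖ψ s‖ ^ 2) := Real.sqrt_pos.2 (by linarith)
  positivity

/-- The function `s ↦ (f(s) + s ψ(s) g(s), s √(1 - |ψ(s)|²) g(s))` that represents the vector
`f(|B|)δ + g(|B|)Bδ`. -/
noncomputable def modelFun (ψ : ℝ → ℂ) (f g : C(ℝ, ℂ)) (s : ℝ) : EuclideanSpace ℂ (Fin 2) :=
  !₂[f s + phaseWeight ψ s * g s, (defectWeight ψ s : ℂ) * g s]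

theorem measurable_modelFun {ψ : ℝ → ℂ} (hψ : Measurable ψ) (f g : C(ℝ, ℂ)) :
    Measurable (modelFun ψ f g) := by
  have := measurable_phaseWeight hψ
  have := measurable_defectWeight hψ
  have hf := f.continuous.measurable
  have hg := g.continuous.measurable
  refine (WithLp.measurable_toLp 2 _).comp (measurable_pi_iff.2 fun i => ?_)
  fin_cases i
  · simp only [Fin.zero_eta, Matrix.cons_val_zero]
    fun_prop
  · simp only [Fin.mk_one, Matrix.cons_val_one, Matrix.cons_val_zero]
    fun_prop

theorem norm_vec_two_le (a b : ℂ) : ‖!₂[a, b]‖ ≤ ‖a‖ + ‖b‖ := by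
  rw [EuclideanSpace.norm_eq, Real.sqrt_le_left (by positivity)]
  simp only [Fin.sum_univ_two, Matrix.cons_val_zero, Matrix.cons_val_one]
  nlinarith [norm_nonneg a, norm_nonneg b]

theorem norm_modelFun_le {ψ : ℝ → ℂ} (h1 : ∀ s : ℝ, 0 < s → ‖ψ s‖ ≤ 1) (f g : C(ℝ, ℂ))
    {s : ℝ} (hs : 0 ≤ s) : ‖modelFun ψ f g s‖ ≤ ‖f s‖ + 2 * s * ‖g s‖ := by
  refine (norm_vec_two_le _ _).trans ?_
  have h2 := norm_phaseWeight_le h1 hs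
  have h3 := defectWeight_le h1 hs
  have h4 : ‖(defectWeight ψ s : ℂ) * g s‖ ≤ s * ‖g s‖ := by
    rw [norm_mul, Complex.norm_real, Real.norm_eq_abs, abs_of_nonneg (defectWeight_nonneg ψ s)]
    gcongr
  have h5 : ‖f s + phaseWeight ψ s * g s‖ ≤ ‖f s‖ + s * ‖g s‖ := by
    refine (norm_add_le _ _).trans ?_
    rw [norm_mul]
    gcongr
  linarith

/-- The terms are grouped so that, after integration, each one is an inner product among `δ` and
`Bδ` with a continuous function of `|B|`. -/
theorem inner_modelFun_self {ψ : ℝ → ℂ} (h1 : ∀ s : ℝ, 0 < s → ‖ψ s‖ ≤ 1) (f g : C(ℝ, ℂ))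
    {s : ℝ} (hs : 0 ≤ s) : inner ℂ (modelFun ψ f g s) (modelFun ψ f g s) =
      (star f * f) s + (star f * g) s * phaseWeight ψ s +
        conj ((star f * g) s * phaseWeight ψ s) + (star g * g * (idFun * idFun)) s := by
  have h2 : phaseWeight ψ s * conj (phaseWeight ψ s) + (defectWeight ψ s : ℂ) ^ 2 = (s : ℂ) ^ 2 := by
    rw [Complex.mul_conj, Complex.normSq_eq_norm_sq]
    exact_mod_cast norm_sq_phaseWeight_add_sq_defectWeight h1 hs
  have h3 : inner ℂ (modelFun ψ f g s) (modelFun ψ f g s) =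
      (f s + phaseWeight ψ s * g s) * conj (f s + phaseWeight ψ s * g s) +
      ((defectWeight ψ s : ℂ) * g s) * conj ((defectWeight ψ s : ℂ) * g s) := by
    simp [modelFun, PiLp.inner_apply, Fin.sum_univ_two, -inner_self_eq_norm_sq_to_K]
  rw [h3]
  simp only [map_add, map_mul, Complex.conj_ofReal, ContinuousMap.mul_apply,
    ContinuousMap.star_apply, idFun, ContinuousMap.coe_mk, RCLike.star_def, Complex.conj_conj]
  linear_combination (g s * conj (g s)) * h2

end Model

/-! ### The isometric representation -/

section Representation

variable {H : Type u} [NormedAddCommGroup H] [InnerProductSpace ℂ H] [CompleteSpace H]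
  {B : H →L⋆[ℂ] H} {δ : H} {ψ : ℝ → ℂ}

theorem ae_nu_nonneg (B : H →L⋆[ℂ] H) (δ : H) : ∀ᵐ s ∂(nu B δ), 0 ≤ s :=
  (ae_mem_spectrum (isSelfAdjoint_absOp B) δ).mono fun _ hs =>
    spectrum_nonneg_of_nonneg (CFC.sqrt_nonneg (square B)) hs

instance (B : H →L⋆[ℂ] H) (δ : H) : IsFiniteMeasure (nu B δ) := by
  unfold nu
  infer_instance

theorem exists_bound_nu (B : H →L⋆[ℂ] H) (δ : H) {E : Type*} [SeminormedAddCommGroup E]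
    {f : ℝ → E} (hf : Continuous f) : ∃ C, ∀ᵐ s ∂(nu B δ), ‖f s‖ ≤ C :=
  exists_bound_of_continuous (isSelfAdjoint_absOp B) δ hf

theorem exists_bound_modelFun (h1 : ∀ s : ℝ, 0 < s → ‖ψ s‖ ≤ 1) (B : H →L⋆[ℂ] H) (δ : H)
    (f g : C(ℝ, ℂ)) : ∃ C, ∀ᵐ s ∂(nu B δ), ‖modelFun ψ f g s‖ ≤ C := by
  obtain ⟨C, hC⟩ := exists_bound_nu B δ (f := fun s => ‖f s‖ + 2 * s * ‖g s‖) (by fun_prop)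
  refine ⟨C, ?_⟩
  filter_upwards [hC, ae_nu_nonneg B δ] with s hs h0
  exact (norm_modelFun_le h1 f g h0).trans ((le_abs_self _).trans hs)

theorem memLp_modelFun (hψ : IsPhaseFunction B δ ψ) (f g : C(ℝ, ℂ)) :
    MemLp (modelFun ψ f g) 2 (nu B δ) := by
  obtain ⟨C, hC⟩ := exists_bound_modelFun hψ.2.1 B δ f g
  exact MemLp.of_bound (measurable_modelFun hψ.1 f g).aestronglyMeasurable C hC

/-- The vector `f(|B|)δ + g(|B|)Bδ`. -/
noncomputable def cyclicVec (B : H →L⋆[ℂ] H) (δ : H) : C(ℝ, ℂ) × C(ℝ, ℂ) →ₗ[ℂ] H where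
  toFun p := contFun (absOp B) p.1 δ + contFun (absOp B) p.2 (B δ)
  map_add' p q := by
    simp only [Prod.fst_add, Prod.snd_add, contFun_add, add_apply]
    abel
  map_smul' c p := by
    simp only [Prod.smul_fst, Prod.smul_snd, contFun_smul, smul_apply, smul_add,
      RingHom.id_apply]

/-- The element of the model space that represents `f(|B|)δ + g(|B|)Bδ`. -/
noncomputable def modelVec (hψ : IsPhaseFunction B δ ψ) :
    C(ℝ, ℂ) × C(ℝ, ℂ) →ₗ[ℂ] Lp (EuclideanSpace ℂ (Fin 2)) 2 (nu B δ) where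
  toFun p := (memLp_modelFun hψ p.1 p.2).toLp (modelFun ψ p.1 p.2)
  map_add' p q := by
    rw [← MemLp.toLp_add]
    congr 1
    ext s i
    fin_cases i <;> simp [modelFun] <;> ring
  map_smul' c p := by
    rw [RingHom.id_apply, ← MemLp.toLp_const_smul]
    congr 1
    ext s i
    fin_cases i <;> simp [modelFun] <;> ring

theorem modelVec_coeFn (hψ : IsPhaseFunction B δ ψ) (p : C(ℝ, ℂ) × C(ℝ, ℂ)) :
    (modelVec hψ p : ℝ → EuclideanSpace ℂ (Fin 2)) =ᵐ[nu B δ] modelFun ψ p.1 p.2 :=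
  MemLp.coeFn_toLp (memLp_modelFun hψ p.1 p.2)

theorem inner_contFun_absOp (B : H →L⋆[ℂ] H) (f g : C(ℝ, ℂ)) (x y : H) :
    inner ℂ (contFun (absOp B) f x) (contFun (absOp B) g y) =
      inner ℂ x (contFun (absOp B) (star f * g) y) := by
  rw [inner_contFun_left, contFun_mul, mul_apply_eq_comp]

theorem inner_contFun_phase (hψ : IsPhaseFunction B δ ψ) (f : C(ℝ, ℂ)) :
    inner ℂ δ (contFun (absOp B) f (B δ)) = ∫ s, f s * phaseWeight ψ s ∂(nu B δ) := by
  rw [contFun, hψ.2.2 f, ← integral_indicator measurableSet_Ioi]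
  congr 1
  ext s
  by_cases hs : 0 < s
  · rw [Set.indicator_of_mem (Set.mem_Ioi.2 hs), phaseWeight, if_pos hs]
    ring
  · rw [Set.indicator_of_notMem (s := Set.Ioi 0) (a := s) hs, phaseWeight, if_neg hs, mul_zero]

/-- A real `f(|B|)` commutes with `B`, and symmetry then moves the outer `B` across to form `B² =
|B|²`. -/
theorem inner_contFun_apply_apply (hB : IsSymm B) {f : C(ℝ, ℂ)} (hf : star f = f) (x : H) :
    inner ℂ (B x) (contFun (absOp B) f (B x)) =
      inner ℂ x (contFun (absOp B) (f * (idFun * idFun)) x) := by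
  rw [contFun_mul, mul_apply_eq_comp, contFun_absOp_sq hB]
  conv_lhs => rw [← hf, ← antilinear_contFun_absOp hB, hB]
  rw [inner_contFun_left, hf]

theorem inner_cyclicVec_self (hB : IsSymm B) (hψ : IsPhaseFunction B δ ψ)
    (p : C(ℝ, ℂ) × C(ℝ, ℂ)) :
    inner ℂ (cyclicVec B δ p) (cyclicVec B δ p) = inner ℂ (modelVec hψ p) (modelVec hψ p) := by
  obtain ⟨f, g⟩ := p
  have hi : ∀ k : C(ℝ, ℂ), Integrable k (nu B δ) := fun k => by
    obtain ⟨C, hC⟩ := exists_bound_nu B δ k.continuous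
    exact Integrable.of_bound k.continuous.aestronglyMeasurable C hC
  have hiφ : Integrable (fun s => (star f * g) s * phaseWeight ψ s) (nu B δ) := by
    obtain ⟨C, hC⟩ := exists_bound_nu B δ
      (f := fun s => (star f * g) s * (s : ℂ)) (by fun_prop)
    refine Integrable.of_bound ((star f * g).continuous.measurable.mul
      (measurable_phaseWeight hψ.1)).aestronglyMeasurable C ?_
    filter_upwards [hC, ae_nu_nonneg B δ] with s hs h0
    refine le_trans ?_ hs
    rw [norm_mul, norm_mul, Complex.norm_real, Real.norm_eq_abs, abs_of_nonneg h0]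
    exact mul_le_mul_of_nonneg_left (norm_phaseWeight_le hψ.2.1 h0) (norm_nonneg _)
  have hsymm : inner ℂ (contFun (absOp B) g (B δ)) (contFun (absOp B) f δ) =
      conj (inner ℂ (contFun (absOp B) f δ) (contFun (absOp B) g (B δ))) :=
    (inner_conj_symm _ _).symm
  have hR : inner ℂ (modelVec hψ (f, g)) (modelVec hψ (f, g)) = ∫ s, ((star f * f) s +
      (star f * g) s * phaseWeight ψ s + conj ((star f * g) s * phaseWeight ψ s) +
      (star g * g * (idFun * idFun)) s) ∂(nu B δ) := by
    rw [L2.inner_def]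
    refine integral_congr_ae ?_
    filter_upwards [modelVec_coeFn hψ (f, g), ae_nu_nonneg B δ] with s hs h0
    rw [hs, inner_modelFun_self hψ.2.1 f g h0]
  have hiφ' : Integrable (fun s => conj ((star f * g) s * phaseWeight ψ s)) (nu B δ) :=
    (LinearIsometryEquiv.integrable_comp_iff Complex.conjLIE).2 hiφ
  have hi2 : Integrable (fun s => (star f * f) s + (star f * g) s * phaseWeight ψ s) (nu B δ) :=
    (hi (star f * f)).add hiφ
  have hi3 : Integrable (fun s => (star f * f) s + (star f * g) s * phaseWeight ψ s +
      conj ((star f * g) s * phaseWeight ψ s)) (nu B δ) := hi2.add hiφ'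
  rw [hR, integral_add hi3 (hi _), integral_add hi2 hiφ', integral_add (hi _) hiφ, integral_conj]
  change inner ℂ (contFun (absOp B) f δ + contFun (absOp B) g (B δ))
    (contFun (absOp B) f δ + contFun (absOp B) g (B δ)) = _
  rw [inner_add_left, inner_add_right, inner_add_right, hsymm]
  simp only [inner_contFun_absOp B]
  -- The mixed term is given by `ψ`, the two diagonal terms by `ν`; `star g * g` is real, as the
  -- reduction of the `Bδ` term requires.
  rw [inner_contFun_phase hψ, inner_contFun_apply_apply hB (by rw [star_mul', star_star, mul_comm]),
    inner_contFun (isSelfAdjoint_absOp B), inner_contFun (isSelfAdjoint_absOp B)]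
  simp only [nu]
  ring

theorem norm_cyclicVec (hB : IsSymm B) (hψ : IsPhaseFunction B δ ψ) (p : C(ℝ, ℂ) × C(ℝ, ℂ)) :
    ‖modelVec hψ p‖ = ‖cyclicVec B δ p‖ := by
  rw [@norm_eq_sqrt_re_inner ℂ, @norm_eq_sqrt_re_inner ℂ _ _ _ _ (cyclicVec B δ p),
    inner_cyclicVec_self hB hψ]

/-- `B` interchanges the two generators up to the factor `|B|²`, so the span of these vectors is
invariant under `B`; it contains `δ`, hence all `Bⁿδ`. -/
theorem apply_cyclicVec (hB : IsSymm B) (f g : C(ℝ, ℂ)) :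
    B (cyclicVec B δ (f, g)) = cyclicVec B δ (star g * (idFun * idFun), star f) := by
  simp only [cyclicVec, LinearMap.coe_mk, AddHom.coe_mk, map_add]
  rw [antilinear_contFun_absOp hB, antilinear_contFun_absOp hB, contFun_mul, mul_apply_eq_comp,
    contFun_absOp_sq hB, add_comm]

theorem iterate_mem_range_cyclicVec (hB : IsSymm B) (n : ℕ) :
    B^[n] δ ∈ (cyclicVec B δ).range := by
  induction n with
  | zero =>
    refine ⟨(1, 0), ?_⟩
    have h0 : contFun (absOp B) (0 : C(ℝ, ℂ)) = 0 := cfc_const_zero ℂ (absOp B)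
    simp [cyclicVec, contFun_one (isSelfAdjoint_absOp B), h0]
  | succ n ih =>
    obtain ⟨⟨f, g⟩, h⟩ := ih
    rw [Function.iterate_succ_apply', ← h, apply_cyclicVec hB]
    exact LinearMap.mem_range_self _ _

theorem denseRange_cyclicVec (hB : IsSymm B) (hcyc : IsCyclicVector B δ) :
    DenseRange (cyclicVec B δ) := by
  rw [DenseRange, dense_iff_closure_eq, ← Set.univ_subset_iff, ← hcyc]
  refine closure_mono ?_
  rintro _ ⟨f, rfl⟩
  have h : polyApply B f δ ∈ (cyclicVec B δ).range :=
    Submodule.sum_mem _ fun n _ => Submodule.smul_mem _ _ (iterate_mem_range_cyclicVec hB n)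
  exact h

theorem contFun_cyclicVec (h f g : C(ℝ, ℂ)) :
    contFun (absOp B) h (cyclicVec B δ (f, g)) = cyclicVec B δ (h * f, h * g) := by
  simp only [cyclicVec, LinearMap.coe_mk, AddHom.coe_mk, map_add, contFun_mul, mul_apply_eq_comp]

/-- The isometry of `H` into `L²(ν; ℂ²)` that maps `f(|B|)δ + g(|B|)Bδ` to
`(f + sψg, s√(1 - |ψ|²)g)`. -/
theorem exists_representation (hB : IsSymm B) (hcyc : IsCyclicVector B δ)
    (hψ : IsPhaseFunction B δ ψ) :
    ∃ U : H →ₗᵢ[ℂ] Lp (EuclideanSpace ℂ (Fin 2)) 2 (nu B δ),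
      ∀ p, U (cyclicVec B δ p) = modelVec hψ p := by
  have hd := denseRange_cyclicVec hB hcyc
  -- A vector may come from several pairs `(f, g)`; equality of norms makes its image independent of
  -- the choice and lets the map extend to the closure.
  have he := LinearMap.extendOfNorm_eq (f := modelVec hψ) hd
    ⟨1, fun p => by rw [one_mul, norm_cyclicVec hB hψ]⟩
  refine ⟨⟨((modelVec hψ).extendOfNorm (cyclicVec B δ)).toLinearMap, fun x => ?_⟩, he⟩
  refine hd.induction_on x (isClosed_eq ?_ continuous_norm) fun p => ?_
  · exact ((modelVec hψ).extendOfNorm (cyclicVec B δ)).continuous.norm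
  · exact (congrArg norm (he p)).trans (norm_cyclicVec hB hψ p)

end Representation

/-! ### Multiplication operators -/

section Multiplication

variable {μ : Measure ℝ} {E : Type*} [NormedAddCommGroup E] [NormedSpace ℂ E]

/-- Multiplication by an essentially bounded function on `L²(μ; E)`. -/
noncomputable def mulOp (E : Type*) [NormedAddCommGroup E] [NormedSpace ℂ E] {m : ℝ → ℂ}
    (hm : MemLp m ⊤ μ) : Lp E 2 μ →L[ℂ] Lp E 2 μ :=
  (ContinuousLinearMap.lsmul ℂ ℂ : ℂ →L[ℂ] E →L[ℂ] E).holderL μ ⊤ 2 2 (hm.toLp m)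

theorem mulOp_coeFn {m : ℝ → ℂ} (hm : MemLp m ⊤ μ) (w : Lp E 2 μ) :
    (mulOp E hm w : ℝ → E) =ᵐ[μ] fun s => m s • w s := by
  filter_upwards [(ContinuousLinearMap.lsmul ℂ ℂ : ℂ →L[ℂ] E →L[ℂ] E).coeFn_holder (r := 2)
    (hm.toLp m) w, hm.coeFn_toLp] with s h1 h2
  rw [← h2]
  exact h1

theorem memLp_indicator_one {S : Set ℝ} (hS : MeasurableSet S) :
    MemLp (S.indicator (1 : ℝ → ℂ)) ⊤ μ := by
  refine memLp_top_of_bound (measurable_one.indicator hS).aestronglyMeasurable 1 (ae_of_all _ ?_)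
  intro s
  by_cases hs : s ∈ S <;> simp [hs]

end Multiplication

/-! ### Range of the representation, spectral projections and multiplicity -/

section Representation

variable {H : Type u} [NormedAddCommGroup H] [InnerProductSpace ℂ H] [CompleteSpace H]
  {B : H →L⋆[ℂ] H} {δ : H} {ψ : ℝ → ℂ}

theorem memLp_top_nu (B : H →L⋆[ℂ] H) (δ : H) (h : C(ℝ, ℂ)) : MemLp h ⊤ (nu B δ) := by
  obtain ⟨C, hC⟩ := exists_bound_nu B δ h.continuous
  exact memLp_top_of_bound h.continuous.aestronglyMeasurable C hC

/-- `U` is the isometric representation of `H` in `L²(ν; ℂ²)`. -/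
def IsRepresentation (hψ : IsPhaseFunction B δ ψ)
    (U : H →ₗᵢ[ℂ] Lp (EuclideanSpace ℂ (Fin 2)) 2 (nu B δ)) : Prop :=
  ∀ p, U (cyclicVec B δ p) = modelVec hψ p

variable {hψ : IsPhaseFunction B δ ψ} {U : H →ₗᵢ[ℂ] Lp (EuclideanSpace ℂ (Fin 2)) 2 (nu B δ)}

theorem IsRepresentation.contFun_apply (hU : IsRepresentation hψ U) (hB : IsSymm B)
    (hcyc : IsCyclicVector B δ) (h : C(ℝ, ℂ)) (x : H) :
    U (contFun (absOp B) h x) = mulOp _ (memLp_top_nu B δ h) (U x) := by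
  refine (denseRange_cyclicVec hB hcyc).induction_on x ?_ ?_
  · exact isClosed_eq (U.continuous.comp (contFun (absOp B) h).continuous)
      ((mulOp _ (memLp_top_nu B δ h)).continuous.comp U.continuous)
  · rintro ⟨f, g⟩
    rw [contFun_cyclicVec, hU, hU]
    refine Lp.ext ?_
    filter_upwards [mulOp_coeFn (memLp_top_nu B δ h) (modelVec hψ (f, g)),
      modelVec_coeFn hψ (f, g), modelVec_coeFn hψ (h * f, h * g)] with s h1 h2 h3
    rw [h1, h2, h3]
    ext i
    fin_cases i <;> simp [modelFun] <;> ring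

theorem IsRepresentation.ae_contFun_apply (hU : IsRepresentation hψ U) (hB : IsSymm B)
    (hcyc : IsCyclicVector B δ) (h : C(ℝ, ℂ)) (x : H) :
    (U (contFun (absOp B) h x) : ℝ → EuclideanSpace ℂ (Fin 2)) =ᵐ[nu B δ]
      fun s => h s • U x s := by
  rw [hU.contFun_apply hB hcyc]
  exact mulOp_coeFn _ _

theorem IsRepresentation.ae_absOp_apply (hU : IsRepresentation hψ U) (hB : IsSymm B)
    (hcyc : IsCyclicVector B δ) (x : H) :
    (U (absOp B x) : ℝ → EuclideanSpace ℂ (Fin 2)) =ᵐ[nu B δ] fun s => (s : ℂ) • U x s := by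
  have := hU.ae_contFun_apply hB hcyc idFun x
  rwa [contFun_id (isSelfAdjoint_absOp B)] at this

theorem measurableSet_multiplicity_two (hψ : IsPhaseFunction B δ ψ) :
    MeasurableSet {s : ℝ | 0 < s ∧ ‖ψ s‖ < 1} :=
  measurableSet_Ioi.inter (measurableSet_lt hψ.1.norm measurable_const)

theorem measurableSet_multiplicity_one (hψ : IsPhaseFunction B δ ψ) :
    MeasurableSet {s : ℝ | 0 < s ∧ ‖ψ s‖ = 1} :=
  measurableSet_Ioi.inter (measurableSet_eq_fun hψ.1.norm measurable_const)

/-- Vanishing off `S₂` is the kernel condition of a bounded operator, hence closed, and it holds on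
the dense cyclic vectors because the defect weight is zero there. -/
theorem IsRepresentation.ae_apply_one_eq_zero (hU : IsRepresentation hψ U) (hB : IsSymm B)
    (hcyc : IsCyclicVector B δ) (x : H) :
    ∀ᵐ s ∂(nu B δ), ¬ (0 < s ∧ ‖ψ s‖ < 1) → U x s 1 = 0 := by
  have hm := memLp_indicator_one (μ := nu B δ) (measurableSet_multiplicity_two hψ).compl
  let P := (EuclideanSpace.proj 1 : EuclideanSpace ℂ (Fin 2) →L[ℂ] ℂ).compLpL 2 (nu B δ)
  have hP : ∀ w, (mulOp ℂ hm (P w) : ℝ → ℂ) =ᵐ[nu B δ]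
      fun s => ({s : ℝ | 0 < s ∧ ‖ψ s‖ < 1}ᶜ).indicator (1 : ℝ → ℂ) s * w s 1 := by
    intro w
    filter_upwards [mulOp_coeFn hm (P w),
      (EuclideanSpace.proj 1 : EuclideanSpace ℂ (Fin 2) →L[ℂ] ℂ).coeFn_compLpL w] with s h1 h2
    rw [h1, h2]
    rfl
  have h0 : mulOp ℂ hm (P (U x)) = 0 := by
    refine (denseRange_cyclicVec hB hcyc).induction_on x ?_ ?_
    · exact isClosed_eq ((mulOp ℂ hm).continuous.comp (P.continuous.comp U.continuous))
        continuous_const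
    · intro p
      rw [hU]
      refine Lp.ext ?_
      filter_upwards [hP (modelVec hψ p), modelVec_coeFn hψ p, Lp.coeFn_zero ℂ 2 (nu B δ)]
        with s h1 h2 h3
      rw [h1, h2, h3]
      by_cases hs : 0 < s ∧ ‖ψ s‖ < 1
      · have hs' : s ∉ {s : ℝ | 0 < s ∧ ‖ψ s‖ < 1}ᶜ := Set.notMem_compl_iff.2 hs
        rw [Set.indicator_of_notMem hs', zero_mul]
        rfl
      · simp [modelFun, defectWeight_eq_zero hψ.2.1 hs]
  filter_upwards [hP (U x), Lp.coeFn_zero ℂ 2 (nu B δ)] with s h1 h2 hs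
  rw [h0, h2, Set.indicator_of_mem (by exact hs)] at h1
  simpa using h1.symm

/-- An element of the model space that is orthogonal to the range of the representation and whose
second component vanishes off the set `|ψ| < 1` is zero. -/
theorem eq_zero_of_forall_inner_modelVec (hψ : IsPhaseFunction B δ ψ)
    {z : Lp (EuclideanSpace ℂ (Fin 2)) 2 (nu B δ)}
    (hz1 : ∀ᵐ s ∂(nu B δ), ¬ (0 < s ∧ ‖ψ s‖ < 1) → z s 1 = 0)
    (hz : ∀ p, inner ℂ (modelVec hψ p) z = 0) : z = 0 := by
  have hint : ∀ i, Integrable (fun s => z s i) (nu B δ) := fun i => by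
    have h := (EuclideanSpace.proj i : EuclideanSpace ℂ (Fin 2) →L[ℂ] ℂ).comp_memLp' (Lp.memLp z)
    exact h.integrable one_le_two
  have hz' : ∀ f g : C(ℝ, ℂ), ∫ s, inner ℂ (modelFun ψ f g s) (z s) ∂(nu B δ) = 0 := by
    intro f g
    rw [← hz (f, g), L2.inner_def]
    refine integral_congr_ae ?_
    filter_upwards [modelVec_coeFn hψ (f, g)] with s hs
    rw [hs]
  -- Testing against pairs `(k, 0)` isolates the first component.
  have h0 : ∀ᵐ s ∂(nu B δ), z s 0 = 0 := by
    refine ae_eq_zero_of_integral_contDiff_smul_eq_zero (hint 0).locallyIntegrable ?_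
    intro k hk _
    rw [← hz' ⟨fun s => (k s : ℂ), Complex.continuous_ofReal.comp hk.continuous⟩ 0]
    congr 1
    ext s
    simp [modelFun, PiLp.inner_apply, Fin.sum_univ_two, mul_comm]
  obtain ⟨C, hC⟩ := exists_bound_nu B δ (f := fun s : ℝ => s) continuous_id
  -- With the first component gone, pairs `(0, k)` see only the second one, weighted by the defect,
  -- which is positive on `S₂`.
  have h1 : ∀ᵐ s ∂(nu B δ), (defectWeight ψ s : ℂ) * z s 1 = 0 := by
    refine ae_eq_zero_of_integral_contDiff_smul_eq_zero (Integrable.locallyIntegrable ?_) ?_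
    · refine (hint 1).bdd_mul (c := C) (Complex.measurable_ofReal.comp
        (measurable_defectWeight hψ.1)).aestronglyMeasurable ?_
      filter_upwards [hC, ae_nu_nonneg B δ] with s hs hs0
      rw [Complex.norm_real, Real.norm_eq_abs, abs_of_nonneg (defectWeight_nonneg ψ s)]
      exact (defectWeight_le hψ.2.1 hs0).trans ((le_abs_self s).trans hs)
    · intro k hk _
      rw [← hz' 0 ⟨fun s => (k s : ℂ), Complex.continuous_ofReal.comp hk.continuous⟩]
      refine integral_congr_ae ?_
      filter_upwards [h0] with s hs
      simp [modelFun, PiLp.inner_apply, Fin.sum_univ_two, hs]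
      ring
  refine Lp.ext ?_
  filter_upwards [h0, h1, hz1, Lp.coeFn_zero (EuclideanSpace ℂ (Fin 2)) 2 (nu B δ)]
    with s hs0 hs1 hs2 hs3
  rw [hs3]
  have hs4 : z s 1 = 0 := by
    by_cases hs : 0 < s ∧ ‖ψ s‖ < 1
    · exact (mul_eq_zero.1 hs1).resolve_left (Complex.ofReal_ne_zero.2 (defectWeight_pos hs).ne')
    · exact hs2 hs
  ext i
  fin_cases i
  · exact hs0
  · exact hs4

/-- The range of an isometry on a complete space is closed, so `w` splits orthogonally. The part `z`
normal to the range is `w - U x`, whose second component also vanishes off `S₂`, and is therefore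
zero. -/
theorem IsRepresentation.exists_apply_eq (hU : IsRepresentation hψ U) (hB : IsSymm B)
    (hcyc : IsCyclicVector B δ) {w : Lp (EuclideanSpace ℂ (Fin 2)) 2 (nu B δ)}
    (hw : ∀ᵐ s ∂(nu B δ), ¬ (0 < s ∧ ‖ψ s‖ < 1) → w s 1 = 0) : ∃ x, U x = w := by
  have : CompleteSpace U.toLinearMap.range :=
    (U.isometry.isUniformInducing.isComplete_range).completeSpace_coe
  obtain ⟨_, ⟨x, rfl⟩, z, hz, hwz⟩ :=
    Submodule.exists_add_mem_mem_orthogonal (K := U.toLinearMap.range) w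
  have hz0 : z = 0 := by
    refine eq_zero_of_forall_inner_modelVec hψ ?_ fun p => ?_
    · have hz' : z = w - U x := by rw [hwz]; exact (add_sub_cancel_left _ _).symm
      filter_upwards [hw, hU.ae_apply_one_eq_zero hB hcyc x, Lp.coeFn_sub w (U x)] with s h1 h2 h3 hs
      rw [hz', h3]
      simp [h1 hs, h2 hs]
    · rw [← hU p]
      exact hz _ (LinearMap.mem_range_self _ _)
  exact ⟨x, by rw [hwz, hz0, add_zero]; rfl⟩

theorem inner_mulOp_indicator {S : Set ℝ} (hS : MeasurableSet S) {μ : Measure ℝ}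
    (w : Lp (EuclideanSpace ℂ (Fin 2)) 2 μ) :
    inner ℂ w (mulOp _ (memLp_indicator_one hS) w) = ((∫ s in S, ‖w s‖ ^ 2 ∂μ : ℝ) : ℂ) := by
  rw [L2.inner_def, ← integral_indicator hS, ← integral_complex_ofReal]
  refine integral_congr_ae ?_
  filter_upwards [mulOp_coeFn (memLp_indicator_one hS) w] with s hs
  rw [hs, inner_smul_right, inner_self_eq_norm_sq_to_K]
  by_cases h : s ∈ S <;> simp [h]

/-- Both measures integrate a bounded continuous `h` to `⟨h(|B|)x, x⟩`, computed once in `H` and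
once in the model. -/
theorem IsRepresentation.spectralMeasure_eq (hU : IsRepresentation hψ U) (hB : IsSymm B)
    (hcyc : IsCyclicVector B δ) (x : H) :
    spectralMeasure (isSelfAdjoint_absOp B) x =
      (nu B δ).withDensity fun s => ENNReal.ofReal (‖U x s‖ ^ 2) := by
  have hint : Integrable (fun s => ‖U x s‖ ^ 2) (nu B δ) :=
    (memLp_two_iff_integrable_sq_norm (Lp.aestronglyMeasurable _)).1 (Lp.memLp (U x))
  have : IsFiniteMeasure ((nu B δ).withDensity fun s => ENNReal.ofReal (‖U x s‖ ^ 2)) :=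
    isFiniteMeasure_withDensity_ofReal hint.2
  refine ext_of_forall_integral_eq_of_IsFiniteMeasure fun h => ?_
  have hm : Measurable fun s => ENNReal.ofReal (‖U x s‖ ^ 2) :=
    ((Lp.stronglyMeasurable (U x)).measurable.norm.pow_const 2).ennreal_ofReal
  rw [integral_withDensity_eq_integral_toReal_smul hm (ae_of_all _ fun _ => ENNReal.ofReal_lt_top)]
  apply Complex.ofReal_injective
  refine (inner_contFun_ofReal (isSelfAdjoint_absOp B) x h.toContinuousMap).symm.trans ?_
  rw [← U.inner_map_map, L2.inner_def,
    ← integral_complex_ofReal]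
  refine integral_congr_ae ?_
  filter_upwards [hU.ae_contFun_apply hB hcyc ⟨fun s => (h s : ℂ), by fun_prop⟩ x] with s hs
  erw [hs]
  rw [inner_smul_right, inner_self_eq_norm_sq_to_K, ENNReal.toReal_ofReal (by positivity)]
  simp [mul_comm]

theorem IsRepresentation.real_spectralMeasure (hU : IsRepresentation hψ U) (hB : IsSymm B)
    (hcyc : IsCyclicVector B δ) (x : H) {S : Set ℝ} (hS : MeasurableSet S) :
    (spectralMeasure (isSelfAdjoint_absOp B) x).real S = ∫ s in S, ‖U x s‖ ^ 2 ∂(nu B δ) := by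
  have hint : Integrable (fun s => ‖U x s‖ ^ 2) (nu B δ) :=
    (memLp_two_iff_integrable_sq_norm (Lp.aestronglyMeasurable _)).1 (Lp.memLp (U x))
  rw [hU.spectralMeasure_eq hB hcyc, Measure.real, withDensity_apply _ hS,
    integral_eq_lintegral_of_nonneg_ae (ae_of_all _ fun _ => by positivity)
      hint.integrableOn.aestronglyMeasurable]

theorem IsRepresentation.spectralProjection_apply (hU : IsRepresentation hψ U) (hB : IsSymm B)
    (hcyc : IsCyclicVector B δ) {S : Set ℝ} (hS : MeasurableSet S) (x : H) :
    U (spectralProjection (isSelfAdjoint_absOp B) S x) =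
      mulOp _ (memLp_indicator_one hS) (U x) := by
  have hE : spectralProjection (isSelfAdjoint_absOp B) S =
      (ContinuousLinearMap.adjoint U.toContinuousLinearMap).comp
        ((mulOp _ (memLp_indicator_one hS)).comp U.toContinuousLinearMap) := by
    refine (existsUnique_spectralProjection (isSelfAdjoint_absOp B) S).unique
      (inner_spectralProjection _ S) fun y => ?_
    rw [ContinuousLinearMap.comp_apply, ContinuousLinearMap.adjoint_inner_right,
      hU.real_spectralMeasure hB hcyc y hS]
    exact inner_mulOp_indicator hS (U y)
  -- `hE` says `E = U* 1_S U`, but `U` need not be onto. Cutting off by `1_S` keeps the second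
  -- component zero off `S₂`, so `1_S U x` lies in the range and `U*` inverts `U` on it.
  obtain ⟨y, hy⟩ := hU.exists_apply_eq hB hcyc
    (w := mulOp _ (memLp_indicator_one hS) (U x)) (by
      filter_upwards [mulOp_coeFn (memLp_indicator_one hS) (U x),
        hU.ae_apply_one_eq_zero hB hcyc x] with s h1 h2 hs
      rw [h1, PiLp.smul_apply, h2 hs, smul_zero])
  have h2 : spectralProjection (isSelfAdjoint_absOp B) S x = y := by
    refine ext_inner_left ℂ fun v => ?_
    rw [hE, ContinuousLinearMap.comp_apply, ContinuousLinearMap.adjoint_inner_right,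
      ← U.inner_map_map v y, hy]
    rfl
  rw [h2, hy]

theorem IsRepresentation.mem_range_spectralProjection_iff (hU : IsRepresentation hψ U)
    (hB : IsSymm B) (hcyc : IsCyclicVector B δ) {S : Set ℝ} (hS : MeasurableSet S) (x : H) :
    x ∈ (spectralProjection (isSelfAdjoint_absOp B) S).range ↔
      ∀ᵐ s ∂(nu B δ), s ∉ S → U x s = 0 := by
  constructor
  · rintro ⟨y, rfl⟩
    have h := hU.spectralProjection_apply hB hcyc hS y
    filter_upwards [mulOp_coeFn (memLp_indicator_one hS) (U y)] with s h1 hs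
    erw [h]
    rw [h1, Set.indicator_of_notMem hs, zero_smul]
  · intro hx
    refine ⟨x, U.injective ?_⟩
    refine (hU.spectralProjection_apply hB hcyc hS x).trans (Lp.ext ?_)
    filter_upwards [mulOp_coeFn (memLp_indicator_one hS) (U x), hx] with s h1 h2
    rw [h1]
    by_cases hs : s ∈ S
    · simp [hs]
    · simp [hs, h2 hs]

theorem IsRepresentation.isMaximalType (hU : IsRepresentation hψ U) (hB : IsSymm B)
    (hcyc : IsCyclicVector B δ) : IsMaximalType (isSelfAdjoint_absOp B) δ := by
  intro S hS h
  rw [inner_spectralProjection, Complex.ofReal_eq_zero, measureReal_eq_zero_iff] at h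
  ext x
  refine U.injective ?_
  rw [hU.spectralProjection_apply hB hcyc hS, zero_apply, map_zero]
  refine Lp.ext ?_
  have hS0 : ∀ᵐ s ∂(nu B δ), s ∉ S := measure_eq_zero_iff_ae_notMem.1 h
  filter_upwards [mulOp_coeFn (memLp_indicator_one hS) (U x), hS0,
    Lp.coeFn_zero (EuclideanSpace ℂ (Fin 2)) 2 (nu B δ)] with s h1 h2 h3
  rw [h1, h3, Set.indicator_of_notMem h2, zero_smul]
  rfl

/-- If on `S` the values of the represented vectors are identified with `ℂⁿ` by linear maps
`P : ℂ² → ℂⁿ` and `J : ℂⁿ → ℂ²`, then the spectrum of `|B|` has multiplicity `n` on `S`. -/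
theorem IsRepresentation.hasSpectralMultiplicityOn (hU : IsRepresentation hψ U) (hB : IsSymm B)
    (hcyc : IsCyclicVector B δ) {S : Set ℝ} (hS : MeasurableSet S) {n : ℕ}
    (P : EuclideanSpace ℂ (Fin 2) →L[ℂ] EuclideanSpace ℂ (Fin n))
    (J : EuclideanSpace ℂ (Fin n) →L[ℂ] EuclideanSpace ℂ (Fin 2)) (hPJ : ∀ v, P (J v) = v)
    (hP : ∀ s ∈ S, ∀ v : EuclideanSpace ℂ (Fin 2),
      (¬ (0 < s ∧ ‖ψ s‖ < 1) → v 1 = 0) → ‖P v‖ = ‖v‖)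
    (hJ : ∀ s ∈ S, ¬ (0 < s ∧ ‖ψ s‖ < 1) → ∀ v, J v 1 = 0) :
    HasSpectralMultiplicityOn (isSelfAdjoint_absOp B) S n := by
  let R := LpToLpRestrictCLM ℝ (EuclideanSpace ℂ (Fin n)) ℂ (nu B δ) 2 S
  have hR : ∀ w : Lp (EuclideanSpace ℂ (Fin 2)) 2 (nu B δ),
      (R (P.compLpL 2 (nu B δ) w) : ℝ → EuclideanSpace ℂ (Fin n))
        =ᵐ[(nu B δ).restrict S] fun s => P (w s) := by
    intro w
    filter_upwards [LpToLpRestrictCLM_coeFn ℂ S (P.compLpL 2 (nu B δ) w),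
      ae_restrict_of_ae (P.coeFn_compLpL (p := 2) w)] with s h1 h2
    rw [h1, h2]
  have hnorm : ∀ x : (spectralProjection (isSelfAdjoint_absOp B) S).range,
      ‖R (P.compLpL 2 (nu B δ) (U x))‖ = ‖x‖ := by
    intro x
    have hx := (hU.mem_range_spectralProjection_iff hB hcyc hS x).1 x.2
    have h1 : ‖x‖ = ‖U x‖ := (U.norm_map x).symm
    rw [h1, @norm_eq_sqrt_re_inner ℂ, @norm_eq_sqrt_re_inner ℂ _ _ _ _ (U x), L2.inner_def,
      L2.inner_def, ← setIntegral_eq_integral_of_ae_compl_eq_zero (s := S)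
        (f := fun s => inner ℂ (U x s) (U x s))
        (hx.mono fun s h hs => by simp only [h hs, inner_zero_left])]
    congr 2
    refine integral_congr_ae ?_
    filter_upwards [hR (U x), ae_restrict_of_ae (hU.ae_apply_one_eq_zero hB hcyc x),
      ae_restrict_mem hS] with s h2 h3 h4
    rw [h2, inner_self_eq_norm_sq_to_K, inner_self_eq_norm_sq_to_K, hP s h4 _ h3]
  let V : (spectralProjection (isSelfAdjoint_absOp B) S).range →ₗᵢ[ℂ]
      Lp (EuclideanSpace ℂ (Fin n)) 2 ((nu B δ).restrict S) :=
    ⟨R.toLinearMap ∘ₗ (P.compLpL 2 (nu B δ)).toLinearMap ∘ₗ U.toLinearMap ∘ₗ Submodule.subtype _,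
      hnorm⟩
  have hV : ∀ x, (V x : ℝ → EuclideanSpace ℂ (Fin n)) =ᵐ[(nu B δ).restrict S]
      fun s => P (U x s) := fun x => hR (U x)
  have hsurj : Function.Surjective V := by
    intro w
    -- The preimage of `w` is sought as `J w` extended by zero off `S`; `hJ` places it in the range
    -- of `U`.
    have hw : MemLp (S.indicator fun s => J (w s)) 2 (nu B δ) :=
      (memLp_indicator_iff_restrict hS).2 (J.comp_memLp' (Lp.memLp w))
    obtain ⟨x, hx⟩ := hU.exists_apply_eq hB hcyc (w := hw.toLp _) (by
      filter_upwards [hw.coeFn_toLp] with s h1 hs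
      rw [h1]
      by_cases hsS : s ∈ S
      · rw [Set.indicator_of_mem hsS, hJ s hsS hs]
      · rw [Set.indicator_of_notMem hsS]
        rfl)
    refine ⟨⟨x, (hU.mem_range_spectralProjection_iff hB hcyc hS x).2 ?_⟩, Lp.ext ?_⟩
    · filter_upwards [hw.coeFn_toLp] with s h1 hs
      rw [hx, h1, Set.indicator_of_notMem hs]
    · refine (hV _).trans ?_
      filter_upwards [ae_restrict_of_ae hw.coeFn_toLp, ae_restrict_mem hS] with s h1 h2
      rw [hx, h1, Set.indicator_of_mem h2, hPJ]
  refine ⟨(nu B δ).restrict S, inferInstance, ?_, LinearIsometryEquiv.ofSurjective V hsurj, ?_⟩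
  · rw [Measure.restrict_apply hS.compl, Set.compl_inter_self, measure_empty]
  · intro x
    have hx := (hU.mem_range_spectralProjection_iff hB hcyc hS x).1 x.2
    have hA := hU.ae_absOp_apply hB hcyc x
    refine ⟨(hU.mem_range_spectralProjection_iff hB hcyc hS _).2 ?_, ?_⟩
    · filter_upwards [hx, hA] with s h1 h2 hs
      rw [h2, h1 hs, smul_zero]
    · refine (hV _).trans ?_
      filter_upwards [hV x, ae_restrict_of_ae hA] with s h1 h2
      rw [h2, map_smul]
      exact congrArg _ h1.symm

theorem IsRepresentation.hasSpectralMultiplicityOn_two (hU : IsRepresentation hψ U)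
    (hB : IsSymm B) (hcyc : IsCyclicVector B δ) :
    HasSpectralMultiplicityOn (isSelfAdjoint_absOp B) {s : ℝ | 0 < s ∧ ‖ψ s‖ < 1} 2 :=
  hU.hasSpectralMultiplicityOn hB hcyc (measurableSet_multiplicity_two hψ)
    (ContinuousLinearMap.id ℂ _) (ContinuousLinearMap.id ℂ _) (fun _ => rfl)
    -- On `S₂` the constraint on the second component is void, so the whole fibre `ℂ²` is kept.
    (fun _ _ _ _ => rfl) (fun _ hs hs' => absurd hs hs')

theorem IsRepresentation.hasSpectralMultiplicityOn_one (hU : IsRepresentation hψ U)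
    (hB : IsSymm B) (hcyc : IsCyclicVector B δ) :
    HasSpectralMultiplicityOn (isSelfAdjoint_absOp B) {s : ℝ | 0 < s ∧ ‖ψ s‖ = 1} 1 := by
  -- Where `|ψ| = 1` the second component is zero, so dropping it preserves the norm.
  let P : EuclideanSpace ℂ (Fin 2) →ₗ[ℂ] EuclideanSpace ℂ (Fin 1) :=
    { toFun := fun v => !₂[v 0]
      map_add' := fun v w => by ext i; fin_cases i; simp
      map_smul' := fun c v => by ext i; fin_cases i; simp }
  let J : EuclideanSpace ℂ (Fin 1) →ₗ[ℂ] EuclideanSpace ℂ (Fin 2) :=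
    { toFun := fun v => !₂[v 0, 0]
      map_add' := fun v w => by ext i; fin_cases i <;> simp
      map_smul' := fun c v => by ext i; fin_cases i <;> simp }
  refine hU.hasSpectralMultiplicityOn hB hcyc (measurableSet_multiplicity_one hψ)
    P.toContinuousLinearMap J.toContinuousLinearMap ?_ ?_ ?_
  · intro v
    ext i
    fin_cases i
    rfl
  · rintro s ⟨-, hs⟩ v hv
    have hv1 : v 1 = 0 := hv fun h => h.2.ne hs
    simp [P, EuclideanSpace.norm_eq, Fin.sum_univ_two, hv1]
  · intro s _ _ v
    rfl

end Representation

end AntiLinear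

theorem proposition2p2 {H : Type*} [NormedAddCommGroup H] [InnerProductSpace ℂ H]
    [CompleteSpace H] (B : H →L⋆[ℂ] H) (hB : AntiLinear.IsSymm B)
    (δ : H) (hδ : ‖δ‖ = 1) (hcyc : AntiLinear.IsCyclicVector B δ)
    (ψ : ℝ → ℂ) (hψ : AntiLinear.IsPhaseFunction B δ ψ) :
    AntiLinear.IsMaximalType (AntiLinear.isSelfAdjoint_absOp B) δ ∧
    AntiLinear.HasSpectralMultiplicityOn (AntiLinear.isSelfAdjoint_absOp B)
      {s : ℝ | 0 < s ∧ ‖ψ s‖ = 1} 1 ∧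
    AntiLinear.HasSpectralMultiplicityOn (AntiLinear.isSelfAdjoint_absOp B)
      {s : ℝ | 0 < s ∧ ‖ψ s‖ < 1} 2 ∧
    (Module.End.HasEigenvalue (AntiLinear.absOp B : H →ₗ[ℂ] H) 0 →
      Module.finrank ℂ (Module.End.eigenspace (AntiLinear.absOp B : H →ₗ[ℂ] H) 0) = 1) := by
  obtain ⟨U, hU⟩ := AntiLinear.exists_representation hB hcyc hψ
  have hU : AntiLinear.IsRepresentation hψ U := hU
  exact ⟨hU.isMaximalType hB hcyc, hU.hasSpectralMultiplicityOn_one hB hcyc,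
    hU.hasSpectralMultiplicityOn_two hB hcyc, AntiLinear.finrank_eigenspace_absOp_zero hB hcyc⟩
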